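/- Let $\mathrm{SU}(2,1)$ be the group of complex $3\times 3$ matrices of determinant $1$ that preserve the indefinite Hermitian form $\langle Z,W\rangle = Z_1\overline{W_1}+Z_2\overline{W_2}-Z_3\overline{W_3}$ on $\mathbb{C}^3$. Write $t_M$ for the trace of a matrix $M$ and $[A,B]=ABA^{-1}B^{-1}$. Let $A,B\in \mathrm{SU}(2,1)$ and put $a=t_A$, $b=t_B$, $c=t_{AB}$, $d=t_{A^{-1}B}$. Then $$\operatorname{Re}(t_{[A,B]})=\tfrac12\left(|ab|^2+|a|^2+|b|^2+|c|^2+|d|^2-ab\overline{c}-\overline{ab}\,c-a\overline{b}d-\overline{a}b\overline{d}-3\right)$$ and $$\begin{aligned} \operatorname{Im}(t_{[A,B]})^2={}&-\tfrac14\left(|ab|^2-|a|^2-|b|^2+|c|^2+|d|^2-ab\overline{c}-\overline{ab}\,c-a\overline{b}d-\overline{a}b\overline{d}\right)^2\\ &+2\operatorname{Re}\Big(-a^3|b|^2+a^2\overline{b}^2\overline{d}+a^2b^2c-a|b|^2\overline{d}c-|a|^2b^3-|a|^2bcd+a^2\overline{c}d\\ &\qquad+a^2\overline{b}c+a^2\overline{d}b+ab^2d-2abc^2+acd^2+\overline{b}\,\overline{d}c^2+b^2c\overline{a}-2bd^2\overline{a}+c^2d\overline{a}\\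 &\qquad+a^3+\tfrac32ab\overline{c}+\tfrac32a\overline{b}d-3ac\overline{d}+b^3+b^2\overline{cd}-3bcd+c^3+d^3+d^2\overline{bc}\Big)\\ &+\tfrac52|ab|^2+|cd|^2-\tfrac92\left(|a|^2+|b|^2+|c|^2+|d|^2\right)+\tfrac{27}{4}. \end{aligned}$$ -/

import Mathlib

open scoped ComplexConjugate

/-- The indefinite inner product `⟨Z, W⟩ = Z₁ W̄₁ + Z₂ W̄₂ - Z₃ W̄₃` on `ℂ³`
(coordinates are numbered from `0` here). -/
def herm21 (Z W : Fin 3 → ℂ) : ℂ :=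
  Z 0 * conj (W 0) + Z 1 * conj (W 1) - Z 2 * conj (W 2)

/-- The group `SU(2,1)`: complex `3 × 3` matrices of determinant one which preserve `herm21`. -/
def SU21 : Subgroup (Matrix.SpecialLinearGroup (Fin 3) ℂ) where
  carrier := {A | ∀ Z W : Fin 3 → ℂ,
    herm21 ((A : Matrix (Fin 3) (Fin 3) ℂ).mulVec Z) ((A : Matrix (Fin 3) (Fin 3) ℂ).mulVec W)
      = herm21 Z W}
  one_mem' := by
    intro Z W
    simp
  mul_mem' := by
    intro A B hA hB Z W
    rw [Matrix.SpecialLinearGroup.coe_mul, ← Matrix.mulVec_mulVec, ← Matrix.mulVec_mulVec,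
      hA, hB]
  inv_mem' := by
    intro A hA Z W
    have h : ∀ V : Fin 3 → ℂ, (A : Matrix (Fin 3) (Fin 3) ℂ).mulVec
        (((A⁻¹ : Matrix.SpecialLinearGroup (Fin 3) ℂ) : Matrix (Fin 3) (Fin 3) ℂ).mulVec V)
          = V := by
      intro V
      rw [Matrix.mulVec_mulVec, ← Matrix.SpecialLinearGroup.coe_mul, mul_inv_cancel,
        Matrix.SpecialLinearGroup.coe_one, Matrix.one_mulVec]
    rw [← hA, h, h]

/-- The trace `t_A` of an element `A` of `SU(2,1)`. -/
noncomputable def trSU21 (A : SU21) : ℂ :=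
  Matrix.trace ((A : Matrix.SpecialLinearGroup (Fin 3) ℂ) : Matrix (Fin 3) (Fin 3) ℂ)

/-! The traces of [A,B] and of its inverse BAB⁻¹A⁻¹ are the roots of a quadratic whose coefficients
are polynomials in the traces of A, B, AB, A⁻¹B and their inverses. In SU(2,1) the trace of an
inverse is the complex conjugate (`SU21.trSU21_inv`), so the sum of the roots is twice the real part
and the discriminant is -4 times the squared imaginary part.

The quadratic is found for all complex 3×3 matrices, with adjugates in place of inverses so that
both sides are polynomial in the entries (`commTraceIdentity`). It is checked directly for diagonal
A, transported by simultaneous conjugation to A with distinct eigenvalues, and extended to every A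
by density. -/

/-! ### Polynomial identities behind the diagonal case. -/

section TraceIdentity

variable {R : Type*} [CommRing R]

/-- The sum of the traces of `A * B * adj A * adj B` and `B * A * adj B * adj A`, for `3 × 3`
matrices of determinants `δ` and `β`, as a polynomial in the traces of `A`, `adj A`, `B`, `adj B`,
`A * B`, `adj B * adj A`, `adj A * B`, `adj B * A`. -/
def commTraceSum (δ β a a' b b' c c' d d' : R) : R :=
  a * a' * b * b' + a * a' * β + b * b' * δ + c * c' + d * d' - a * b * c' - a' * b' * c
    - a * b' * d - a' * b * d' - 3 * δ * β

/-- The square of the difference of the traces of `A * B * adj A * adj B` and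
`B * A * adj B * adj A`, as a polynomial in the same traces as in `commTraceSum`. -/
def commTraceDisc (δ β a a' b b' c c' d d' : R) : R :=
  (a * a' * b * b' - a * a' * β - b * b' * δ + c * c' + d * d' - a * b * c' - a' * b' * c
      - a * b' * d - a' * b * d') ^ 2 + 4 * a ^ 3 * b * b' * δ * β - 4 * a ^ 2 * b' ^ 2 * d' * δ
    - 4 * a ^ 2 * b ^ 2 * c * δ * β + 4 * a * b * b' * c * d' * δ + 4 * a * a' * b ^ 3 * δ * β
    + 4 * a * a' * b * c * d * β - 4 * a ^ 2 * c' * d * β - 4 * a ^ 2 * b' * c * δ * β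
    - 4 * a ^ 2 * b * d' * δ * β - 4 * a * b ^ 2 * d * δ * β + 8 * a * b * c ^ 2 * δ * β
    - 4 * a * c * d ^ 2 * β - 4 * b' * c ^ 2 * d' * δ - 4 * a' * b ^ 2 * c * δ * β
    + 8 * a' * b * d ^ 2 * β - 4 * a' * c ^ 2 * d * β - 4 * a ^ 3 * δ * β ^ 2
    - 6 * a * b * c' * δ * β - 6 * a * b' * d * δ * β + 12 * a * c * d' * δ * β
    - 4 * b ^ 3 * δ ^ 2 * β - 4 * b ^ 2 * c' * d' * δ + 12 * b * c * d * δ * β - 4 * c ^ 3 * δ * β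
    - 4 * d ^ 3 * β - 4 * b' * c' * d ^ 2 + 4 * a' ^ 3 * b * b' * β - 4 * a' ^ 2 * b ^ 2 * d * β
    - 4 * a' ^ 2 * b' ^ 2 * c' + 4 * a' * b * b' * c' * d + 4 * a * a' * b' ^ 3 * δ
    + 4 * a * a' * b' * c' * d' - 4 * a' ^ 2 * c * d' * β - 4 * a' ^ 2 * b * c' * β
    - 4 * a' ^ 2 * b' * d * β - 4 * a' * b' ^ 2 * d' * δ + 8 * a' * b' * c' ^ 2
    - 4 * a' * c' * d' ^ 2 - 4 * b * c' ^ 2 * d - 4 * a * b' ^ 2 * c' * δ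
    + 8 * a * b' * d' ^ 2 * δ - 4 * a * c' ^ 2 * d' - 4 * a' ^ 3 * β ^ 2 - 6 * a' * b' * c * δ * β
    - 6 * a' * b * d' * δ * β + 12 * a' * c' * d * β - 4 * b' ^ 3 * δ ^ 2 - 4 * b' ^ 2 * c * d * δ
    + 12 * b' * c' * d' * δ - 4 * c' ^ 3 - 4 * d' ^ 3 * δ - 4 * b * c * d' ^ 2 * δ
    - 10 * a * a' * b * b' * δ * β - 4 * c * c' * d * d' + 18 * a * a' * δ * β ^ 2
    + 18 * b * b' * δ ^ 2 * β + 18 * c * c' * δ * β + 18 * d * d' * δ * β - 27 * δ ^ 2 * β ^ 2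

/-- Here A = diag(x, y, z), and B has diagonal p, q, r, products i, j, k of opposite off-diagonal
entries, and 3-cycle products u, w. The two bracketed summands are the two traces. -/
theorem commTraceSum_diagonal (x y z p q r i j k u w : R) :
    (x * y * z * (p * (q * r - i) + q * (r * p - j) + r * (p * q - k))
        + x ^ 2 * z * (u - r * k) + y ^ 2 * x * (u - p * i) + z ^ 2 * y * (u - q * j)
        + y ^ 2 * z * (w - r * k) + z ^ 2 * x * (w - p * i) + x ^ 2 * y * (w - q * j))
      + (x * y * z * (p * (q * r - i) + q * (r * p - j) + r * (p * q - k))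
        + x ^ 2 * z * (w - r * k) + y ^ 2 * x * (w - p * i) + z ^ 2 * y * (w - q * j)
        + y ^ 2 * z * (u - r * k) + z ^ 2 * x * (u - p * i) + x ^ 2 * y * (u - q * j))
      = commTraceSum (x * y * z) (p * q * r - p * i - q * j - r * k + u + w)
          (x + y + z) (y * z + z * x + x * y)
          (p + q + r) (q * r - i + (r * p - j) + (p * q - k))
          (x * p + y * q + z * r)
          (y * z * (q * r - i) + z * x * (r * p - j) + x * y * (p * q - k))
          (y * z * p + z * x * q + x * y * r)
          (x * (q * r - i) + y * (r * p - j) + z * (p * q - k)) := by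
  simp only [commTraceSum]
  ring

/-- In this lemma i, j, k stand for the principal 2×2 minors of B, and β is free. This removes u and
w, leaving an identity without side condition. -/
theorem commTraceDisc_diagonal_aux (x y z p q r i j k β : R) :
    ((x - y) * (y - z) * (z - x)) ^ 2
        * ((β + 2 * (p * q * r) - p * i - q * j - r * k) ^ 2
          - 4 * ((q * r - i) * (r * p - j) * (p * q - k)))
      = commTraceDisc (x * y * z) β
          (x + y + z) (y * z + z * x + x * y) (p + q + r) (i + j + k)
          (x * p + y * q + z * r) (y * z * i + z * x * j + x * y * k)
          (y * z * p + z * x * q + x * y * r) (x * i + y * j + z * k) := by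
  simp only [commTraceDisc]
  ring

theorem commTraceDisc_diagonal (x y z p q r i j k u w : R) (h : u * w = i * j * k) :
    ((x - y) * (y - z) * (z - x) * (u - w)) ^ 2
      = commTraceDisc (x * y * z) (p * q * r - p * i - q * j - r * k + u + w)
          (x + y + z) (y * z + z * x + x * y)
          (p + q + r) (q * r - i + (r * p - j) + (p * q - k))
          (x * p + y * q + z * r)
          (y * z * (q * r - i) + z * x * (r * p - j) + x * y * (p * q - k))
          (y * z * p + z * x * q + x * y * r)
          (x * (q * r - i) + y * (r * p - j) + z * (p * q - k)) := by
  -- With the minors and the determinant substituted, the second factor becomes (u + w)² - 4ijk,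
  -- which is (u - w)² because uw = ijk.
  rw [← commTraceDisc_diagonal_aux]
  linear_combination (-4 * ((x - y) * (y - z) * (z - x)) ^ 2) * h

end TraceIdentity

/-! ### The trace identity for diagonal A, and its invariance under conjugation. -/

section CommutatorTraces

open Matrix

variable {R : Type*} [CommRing R]

theorem continuous_commTraceSum {X : Type*} [TopologicalSpace X] [TopologicalSpace R]
    [IsTopologicalRing R] {δ β a a' b b' c c' d d' : X → R} (hδ : Continuous δ)
    (hβ : Continuous β) (ha : Continuous a) (ha' : Continuous a') (hb : Continuous b)
    (hb' : Continuous b') (hc : Continuous c) (hc' : Continuous c') (hd : Continuous d)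
    (hd' : Continuous d') :
    Continuous fun x => commTraceSum (δ x) (β x) (a x) (a' x) (b x) (b' x) (c x) (c' x) (d x)
      (d' x) := by
  unfold commTraceSum
  fun_prop

theorem continuous_commTraceDisc {X : Type*} [TopologicalSpace X] [TopologicalSpace R]
    [IsTopologicalRing R] {δ β a a' b b' c c' d d' : X → R} (hδ : Continuous δ)
    (hβ : Continuous β) (ha : Continuous a) (ha' : Continuous a') (hb : Continuous b)
    (hb' : Continuous b') (hc : Continuous c) (hc' : Continuous c') (hd : Continuous d)
    (hd' : Continuous d') :
    Continuous fun x => commTraceDisc (δ x) (β x) (a x) (a' x) (b x) (b' x) (c x) (c' x) (d x)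
      (d' x) := by
  unfold commTraceDisc
  fun_prop

/-- The traces of `A * B * adj A * adj B` and `B * A * adj B * adj A` are the roots of the monic
quadratic polynomial with sum of roots `commTraceSum` and discriminant `commTraceDisc`. -/
def CommTraceIdentity (A B : Matrix (Fin 3) (Fin 3) R) : Prop :=
  trace (A * B * A.adjugate * B.adjugate) + trace (B * A * B.adjugate * A.adjugate)
      = commTraceSum A.det B.det (trace A) (trace A.adjugate) (trace B) (trace B.adjugate)
          (trace (A * B)) (trace (B.adjugate * A.adjugate))
          (trace (A.adjugate * B)) (trace (B.adjugate * A)) ∧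
    (trace (A * B * A.adjugate * B.adjugate) - trace (B * A * B.adjugate * A.adjugate)) ^ 2
      = commTraceDisc A.det B.det (trace A) (trace A.adjugate) (trace B) (trace B.adjugate)
          (trace (A * B)) (trace (B.adjugate * A.adjugate))
          (trace (A.adjugate * B)) (trace (B.adjugate * A))

theorem trace_diagonal_mul_mul_diagonal_mul {n : Type*} [Fintype n] [DecidableEq n]
    (l m : n → R) (B C : Matrix n n R) :
    trace (diagonal l * B * diagonal m * C) = ∑ i, ∑ j, l i * B i j * m j * C j i := by
  simp only [trace, diag_apply]
  refine Finset.sum_congr rfl fun i _ => ?_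
  rw [mul_apply]
  simp only [mul_diagonal, diagonal_mul]

theorem trace_mul_diagonal_mul_mul_diagonal {n : Type*} [Fintype n] [DecidableEq n]
    (l m : n → R) (B C : Matrix n n R) :
    trace (B * diagonal l * C * diagonal m) = ∑ i, ∑ j, B i j * l j * C j i * m i := by
  simp only [trace, diag_apply]
  refine Finset.sum_congr rfl fun i _ => ?_
  rw [mul_diagonal, mul_apply, Finset.sum_mul]
  simp only [mul_diagonal]

theorem commTraceIdentity_diagonal (l : Fin 3 → R) (B : Matrix (Fin 3) (Fin 3) R) :
    CommTraceIdentity (diagonal l) B := by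
  have hl : (diagonal l).adjugate = diagonal ![l 1 * l 2, l 2 * l 0, l 0 * l 1] := by
    rw [adjugate_fin_three]
    ext i j
    fin_cases i <;> fin_cases j <;> simp [mul_comm]
  have hδ : (diagonal l).det = l 0 * l 1 * l 2 := by
    simp [Fin.prod_univ_three]
  have hβ : B.det = B 0 0 * B 1 1 * B 2 2 - B 0 0 * (B 1 2 * B 2 1) - B 1 1 * (B 2 0 * B 0 2)
      - B 2 2 * (B 0 1 * B 1 0) + B 0 1 * B 1 2 * B 2 0 + B 1 0 * B 0 2 * B 2 1 := by
    rw [det_fin_three]; ring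
  have ha : trace (diagonal l) = l 0 + l 1 + l 2 := by
    simp [Fin.sum_univ_three]
  have ha' : trace (diagonal l).adjugate = l 1 * l 2 + l 2 * l 0 + l 0 * l 1 := by
    rw [hl]; simp [Fin.sum_univ_three]
  have hb : trace B.adjugate = B 1 1 * B 2 2 - B 1 2 * B 2 1 + (B 2 2 * B 0 0 - B 2 0 * B 0 2)
      + (B 0 0 * B 1 1 - B 0 1 * B 1 0) := by
    rw [adjugate_fin_three]; simp [trace_fin_three]; ring
  have hc : trace (diagonal l * B) = l 0 * B 0 0 + l 1 * B 1 1 + l 2 * B 2 2 := by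
    simp [trace_fin_three]
  have hc' : trace (B.adjugate * (diagonal l).adjugate)
      = l 1 * l 2 * (B 1 1 * B 2 2 - B 1 2 * B 2 1) + l 2 * l 0 * (B 2 2 * B 0 0 - B 2 0 * B 0 2)
        + l 0 * l 1 * (B 0 0 * B 1 1 - B 0 1 * B 1 0) := by
    rw [hl, trace_fin_three]; simp only [mul_diagonal, adjugate_fin_three]; simp; ring
  have hd : trace ((diagonal l).adjugate * B)
      = l 1 * l 2 * B 0 0 + l 2 * l 0 * B 1 1 + l 0 * l 1 * B 2 2 := by
    rw [hl]; simp [trace_fin_three]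
  have hd' : trace (B.adjugate * diagonal l)
      = l 0 * (B 1 1 * B 2 2 - B 1 2 * B 2 1) + l 1 * (B 2 2 * B 0 0 - B 2 0 * B 0 2)
        + l 2 * (B 0 0 * B 1 1 - B 0 1 * B 1 0) := by
    rw [trace_fin_three]; simp only [mul_diagonal, adjugate_fin_three]; simp; ring
  have hS := commTraceSum_diagonal (l 0) (l 1) (l 2) (B 0 0) (B 1 1) (B 2 2) (B 1 2 * B 2 1)
    (B 2 0 * B 0 2) (B 0 1 * B 1 0) (B 0 1 * B 1 2 * B 2 0) (B 1 0 * B 0 2 * B 2 1)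
  have hD := commTraceDisc_diagonal (l 0) (l 1) (l 2) (B 0 0) (B 1 1) (B 2 2) (B 1 2 * B 2 1)
    (B 2 0 * B 0 2) (B 0 1 * B 1 0) (B 0 1 * B 1 2 * B 2 0) (B 1 0 * B 0 2 * B 2 1) (by ring)
  unfold CommTraceIdentity
  rw [hδ, hβ, ha, ha', trace_fin_three B, hb, hc, hc', hd, hd', ← hS, ← hD, hl,
    trace_diagonal_mul_mul_diagonal_mul, trace_mul_diagonal_mul_mul_diagonal]
  constructor <;> simp [Fin.sum_univ_three, adjugate_fin_three B] <;> ring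

/-- The adjugate reverses products, adj P = det P • Q and adj Q = det Q • P, and the two scalars
multiply to 1. -/
theorem adjugate_conj {n : Type*} [Fintype n] [DecidableEq n] {P Q : Matrix n n R}
    (h : P * Q = 1) (M : Matrix n n R) :
    (P * M * Q).adjugate = P * M.adjugate * Q := by
  have hQP : Q * P = 1 := mul_eq_one_comm.mp h
  have hQ : Q.adjugate = Q.det • P := by
    rw [← Matrix.mul_one Q.adjugate, ← hQP, ← Matrix.mul_assoc, adjugate_mul, Matrix.smul_mul,
      Matrix.one_mul]
  have hP : P.adjugate = P.det • Q := by
    rw [← Matrix.mul_one P.adjugate, ← h, ← Matrix.mul_assoc, adjugate_mul, Matrix.smul_mul,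
      Matrix.one_mul]
  have hdet : P.det * Q.det = 1 := by rw [← det_mul, h, det_one]
  rw [adjugate_mul_distrib, adjugate_mul_distrib, hQ, hP]
  simp only [Matrix.smul_mul, Matrix.mul_smul, smul_smul, hdet, one_smul, Matrix.mul_assoc]

theorem CommTraceIdentity.conj {A B P Q : Matrix (Fin 3) (Fin 3) R} (h : P * Q = 1)
    (hAB : CommTraceIdentity A B) : CommTraceIdentity (P * A * Q) (P * B * Q) := by
  have hQP : Q * P = 1 := mul_eq_one_comm.mp h
  have hmul : ∀ X Y : Matrix (Fin 3) (Fin 3) R, P * X * Q * (P * Y * Q) = P * (X * Y) * Q := by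
    intro X Y
    calc P * X * Q * (P * Y * Q) = P * X * (Q * P) * Y * Q := by simp only [Matrix.mul_assoc]
      _ = P * (X * Y) * Q := by rw [hQP, Matrix.mul_one, Matrix.mul_assoc P]
  have htr : ∀ X : Matrix (Fin 3) (Fin 3) R, trace (P * X * Q) = trace X := by
    intro X
    rw [trace_mul_comm, ← Matrix.mul_assoc, hQP, Matrix.one_mul]
  have hdet : ∀ X : Matrix (Fin 3) (Fin 3) R, (P * X * Q).det = X.det := by
    intro X
    rw [det_mul_comm, ← Matrix.mul_assoc, hQP, Matrix.one_mul]
  simpa only [CommTraceIdentity, adjugate_conj h, hmul, htr, hdet] using hAB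

end CommutatorTraces

/-! ### Diagonalization for distinct eigenvalues, and passage to all matrices by density. -/

section Diagonalization

open Matrix

variable {K : Type*} [Field K]

/-- The characteristic polynomial of a `3 × 3` matrix, as a `Cubic`. -/
def charCubic {R : Type*} [CommRing R] (A : Matrix (Fin 3) (Fin 3) R) : Cubic R :=
  ⟨1, -trace A, trace A.adjugate, -A.det⟩

theorem det_sub_scalar {R : Type*} [CommRing R] (A : Matrix (Fin 3) (Fin 3) R) (x : R) :
    (A - x • (1 : Matrix (Fin 3) (Fin 3) R)).det
      = -(x ^ 3 - trace A * x ^ 2 + trace A.adjugate * x - A.det) := by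
  rw [adjugate_fin_three, det_fin_three, det_fin_three A]
  simp [trace_fin_three]
  ring

/-- A nonzero discriminant gives three distinct roots; their eigenvectors are independent and form
the columns of P. -/
theorem exists_diagonalization [IsAlgClosed K] {A : Matrix (Fin 3) (Fin 3) K}
    (hA : (charCubic A).discr ≠ 0) :
    ∃ (P Q : Matrix (Fin 3) (Fin 3) K) (l : Fin 3 → K), P * Q = 1 ∧ A = P * diagonal l * Q := by
  have h1 : (charCubic A).a ≠ 0 := one_ne_zero
  obtain ⟨x, y, z, h3⟩ := (Cubic.splits_iff_roots_eq_three (φ := RingHom.id K) h1).mp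
    (IsAlgClosed.splits _)
  obtain ⟨hxy, hxz, hyz⟩ := (Cubic.discr_ne_zero_iff_roots_ne h1 h3).mp hA
  have hinj : Function.Injective ![x, y, z] := by
    intro i j
    fin_cases i <;> fin_cases j <;> simp [hxy, hxz, hyz, hxy.symm, hxz.symm, hyz.symm]
  have hroot : ∀ i, ∃ v : Fin 3 → K, v ≠ 0 ∧ A *ᵥ v = ![x, y, z] i • v := by
    intro i
    have hd : (A - ![x, y, z] i • (1 : Matrix (Fin 3) (Fin 3) K)).det = 0 := by
      have hb := Cubic.b_eq_three_roots h1 h3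
      have hc := Cubic.c_eq_three_roots h1 h3
      have hd := Cubic.d_eq_three_roots h1 h3
      simp only [charCubic, RingHom.id_apply] at hb hc hd
      rw [det_sub_scalar, neg_eq_zero]
      fin_cases i <;> simp
      · linear_combination x ^ 2 * hb + x * hc + hd
      · linear_combination y ^ 2 * hb + y * hc + hd
      · linear_combination z ^ 2 * hb + z * hc + hd
    obtain ⟨v, hv, hv0⟩ := exists_mulVec_eq_zero_iff.mpr hd
    refine ⟨v, hv, ?_⟩
    rwa [sub_mulVec, smul_mulVec, one_mulVec, sub_eq_zero] at hv0
  choose v hv hAv using hroot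
  have hli : LinearIndependent K v := by
    refine Module.End.eigenvectors_linearIndependent' (Matrix.toLin' A) _ hinj v fun i => ⟨?_, hv i⟩
    rw [Module.End.mem_eigenspace_iff, toLin'_apply, hAv]
  have hunit : IsUnit (Matrix.of v)ᵀ := by
    rw [isUnit_transpose, ← linearIndependent_rows_iff_isUnit]
    exact hli
  have hdet := (isUnit_iff_isUnit_det _).mp hunit
  refine ⟨(Matrix.of v)ᵀ, ((Matrix.of v)ᵀ)⁻¹, ![x, y, z], mul_nonsing_inv _ hdet, ?_⟩
  have hAP : A * (Matrix.of v)ᵀ = (Matrix.of v)ᵀ * diagonal ![x, y, z] := by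
    ext i j
    have := congrFun (hAv j) i
    rw [mul_diagonal]
    simpa [mul_apply, mulVec, dotProduct, mul_comm] using this
  rw [← hAP, mul_nonsing_inv_cancel_right _ _ hdet]

theorem CommTraceIdentity.of_discr_ne_zero {K : Type*} [Field K] [IsAlgClosed K]
    {A : Matrix (Fin 3) (Fin 3) K} (hA : (charCubic A).discr ≠ 0)
    (B : Matrix (Fin 3) (Fin 3) K) : CommTraceIdentity A B := by
  obtain ⟨P, Q, l, h, rfl⟩ := exists_diagonalization hA
  have hB : B = P * (Q * B * P) * Q := by
    calc B = (P * Q) * B * (P * Q) := by rw [h, Matrix.one_mul, Matrix.mul_one]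
      _ = P * (Q * B * P) * Q := by simp only [Matrix.mul_assoc]
  rw [hB]
  exact (commTraceIdentity_diagonal l _).conj h

/-- Along the line from A to D the discriminant is a polynomial in s, nonzero at s = 1, so it has
finitely many zeros. -/
theorem dense_discr_ne_zero {D : Matrix (Fin 3) (Fin 3) ℂ} (hD : (charCubic D).discr ≠ 0)
    (A : Matrix (Fin 3) (Fin 3) ℂ) :
    Dense {s : ℂ | (charCubic (A + s • (D - A))).discr ≠ 0} := by
  let M : Matrix (Fin 3) (Fin 3) (Polynomial ℂ) :=
    A.map Polynomial.C + (Polynomial.X : Polynomial ℂ) •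
      (D - A).map Polynomial.C
  let f : Polynomial ℂ := (charCubic M).discr
  have hM : ∀ s : ℂ, (Polynomial.evalRingHom s).mapMatrix M
      = A + s • (D - A) := by
    intro s
    ext i j
    simp [M]
  have hf : ∀ s : ℂ, f.eval s = (charCubic (A + s • (D - A))).discr := by
    intro s
    have hdet : Polynomial.eval s M.det = (A + s • (D - A)).det := by
      rw [← hM, ← RingHom.map_det, Polynomial.coe_evalRingHom]
    have htr : ∀ N : Matrix (Fin 3) (Fin 3) (Polynomial ℂ),
        Polynomial.eval s (trace N) = trace ((Polynomial.evalRingHom s).mapMatrix N) := by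
      intro N
      simp [trace_fin_three]
    simp only [f, charCubic, Cubic.discr, Polynomial.eval_sub, Polynomial.eval_add,
      Polynomial.eval_mul, Polynomial.eval_pow, Polynomial.eval_neg, Polynomial.eval_one,
      Polynomial.eval_ofNat, hdet, htr, RingHom.map_adjugate, hM]
  have hf1 : f.eval 1 ≠ 0 := by
    rwa [hf, one_smul, add_sub_cancel]
  have hf0 : f ≠ 0 := by
    rintro h
    simp [h] at hf1
  have hset : {s : ℂ | (charCubic (A + s • (D - A))).discr ≠ 0}
      = {s : ℂ | f.IsRoot s}ᶜ := by
    ext s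
    simp [Polynomial.IsRoot, hf]
  rw [hset]
  exact (Polynomial.finite_setOfPred_isRoot hf0).countable.dense_compl ℂ

theorem isClosed_commTraceIdentity (B : Matrix (Fin 3) (Fin 3) ℂ) :
    IsClosed {A | CommTraceIdentity A B} := by
  have hid : Continuous fun A : Matrix (Fin 3) (Fin 3) ℂ => A := continuous_id
  have hadj : Continuous fun A : Matrix (Fin 3) (Fin 3) ℂ => A.adjugate := hid.matrix_adjugate
  have hc : ∀ C : Matrix (Fin 3) (Fin 3) ℂ,
      Continuous fun _ : Matrix (Fin 3) (Fin 3) ℂ => C := fun _ => continuous_const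
  have h1 := (((hid.matrix_mul (hc B)).matrix_mul hadj).matrix_mul (hc B.adjugate)).matrix_trace
  have h2 := ((((hc B).matrix_mul hid).matrix_mul (hc B.adjugate)).matrix_mul hadj).matrix_trace
  have hS := continuous_commTraceSum (β := fun _ => B.det) (b := fun _ => trace B)
    (b' := fun _ => trace B.adjugate) hid.matrix_det continuous_const hid.matrix_trace
    hadj.matrix_trace continuous_const continuous_const (hid.matrix_mul (hc B)).matrix_trace
    ((hc B.adjugate).matrix_mul hadj).matrix_trace (hadj.matrix_mul (hc B)).matrix_trace
    ((hc B.adjugate).matrix_mul hid).matrix_trace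
  have hD := continuous_commTraceDisc (β := fun _ => B.det) (b := fun _ => trace B)
    (b' := fun _ => trace B.adjugate) hid.matrix_det continuous_const hid.matrix_trace
    hadj.matrix_trace continuous_const continuous_const (hid.matrix_mul (hc B)).matrix_trace
    ((hc B.adjugate).matrix_mul hadj).matrix_trace (hadj.matrix_mul (hc B)).matrix_trace
    ((hc B.adjugate).matrix_mul hid).matrix_trace
  exact (isClosed_eq (h1.add h2) hS).inter (isClosed_eq ((h1.sub h2).pow 2) hD)

theorem commTraceIdentity (A B : Matrix (Fin 3) (Fin 3) ℂ) : CommTraceIdentity A B := by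
  -- Any matrix with distinct eigenvalues would serve; the line towards it passes through A at s =
  -- 0.
  let D : Matrix (Fin 3) (Fin 3) ℂ := !![0, 0, 0; 0, 1, 0; 0, 0, 2]
  have hD : (charCubic D).discr ≠ 0 := by
    have : (charCubic D).discr = 4 := by
      simp [D, charCubic, Cubic.discr, trace_fin_three, det_fin_three, adjugate_fin_three]
      norm_num
    rw [this]
    norm_num
  have hcl : IsClosed {s : ℂ | CommTraceIdentity (A + s • (D - A)) B} :=
    (isClosed_commTraceIdentity B).preimage
      (continuous_const.add (continuous_id.smul continuous_const))
  have hdense : Dense {s : ℂ | CommTraceIdentity (A + s • (D - A)) B} :=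
    (dense_discr_ne_zero hD A).mono fun _ hs => CommTraceIdentity.of_discr_ne_zero hs B
  have h0 : CommTraceIdentity (A + (0 : ℂ) • (D - A)) B :=
    hcl.closure_subset (hdense 0)
  simpa using h0

end Diagonalization

/-! ### Specialization to SU(2,1). -/

namespace SU21

/-- The underlying matrix of an element of `SU(2,1)`. -/
def toMatrix : SU21 →* Matrix (Fin 3) (Fin 3) ℂ where
  toFun A := ((A : Matrix.SpecialLinearGroup (Fin 3) ℂ) : Matrix (Fin 3) (Fin 3) ℂ)
  map_one' := rfl
  map_mul' _ _ := rfl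

theorem trSU21_eq (A : SU21) : trSU21 A = Matrix.trace (toMatrix A) := rfl

theorem det_toMatrix (A : SU21) : (toMatrix A).det = 1 := A.1.2

theorem toMatrix_inv (A : SU21) : toMatrix A⁻¹ = (toMatrix A).adjugate :=
  Matrix.SpecialLinearGroup.coe_inv A.1

theorem herm21_toMatrix (A : SU21) (Z W : Fin 3 → ℂ) :
    herm21 ((toMatrix A).mulVec Z) ((toMatrix A).mulVec W) = herm21 Z W := A.2 Z W

theorem trSU21_inv (A : SU21) : trSU21 A⁻¹ = conj (trSU21 A) := by
  -- A⁻¹ is the adjoint of A for the form. On basis vectors this conjugates diagonal entries; the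
  -- sign of the last coordinate occurs on both sides and cancels.
  have key : ∀ Z W : Fin 3 → ℂ,
      herm21 ((toMatrix A⁻¹).mulVec Z) W = herm21 Z ((toMatrix A).mulVec W) := by
    intro Z W
    rw [← herm21_toMatrix A, Matrix.mulVec_mulVec, ← map_mul, mul_inv_cancel, map_one,
      Matrix.one_mulVec]
  have h0 := key (Pi.single 0 1) (Pi.single 0 1)
  have h1 := key (Pi.single 1 1) (Pi.single 1 1)
  have h2 := key (Pi.single 2 1) (Pi.single 2 1)
  simp [herm21] at h0 h1 h2
  simp only [trSU21_eq, Matrix.trace_fin_three, map_add, h0, h1, h2]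

end SU21

theorem proposition2p3 (A B : SU21) (a b c d : ℂ)
    (ha : a = trSU21 A) (hb : b = trSU21 B)
    (hc : c = trSU21 (A * B)) (hd : d = trSU21 (A⁻¹ * B)) :
    (((trSU21 (A * B * A⁻¹ * B⁻¹)).re : ℝ) : ℂ)
      = (1 / 2 : ℂ) * ((‖a * b‖ : ℂ) ^ 2 + (‖a‖ : ℂ) ^ 2 + (‖b‖ : ℂ) ^ 2 + (‖c‖ : ℂ) ^ 2
          + (‖d‖ : ℂ) ^ 2 - a * b * conj c - conj (a * b) * c - a * conj b * d
          - conj a * b * conj d - 3)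
    ∧
    (((trSU21 (A * B * A⁻¹ * B⁻¹)).im : ℝ) : ℂ) ^ 2
      = -(1 / 4 : ℂ) * ((‖a * b‖ : ℂ) ^ 2 - (‖a‖ : ℂ) ^ 2 - (‖b‖ : ℂ) ^ 2 + (‖c‖ : ℂ) ^ 2
          + (‖d‖ : ℂ) ^ 2 - a * b * conj c - conj (a * b) * c - a * conj b * d
          - conj a * b * conj d) ^ 2
        + 2 * (((
            -a ^ 3 * (‖b‖ : ℂ) ^ 2 + a ^ 2 * conj b ^ 2 * conj d + a ^ 2 * b ^ 2 * c
            - a * (‖b‖ : ℂ) ^ 2 * conj d * c - (‖a‖ : ℂ) ^ 2 * b ^ 3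
            - (‖a‖ : ℂ) ^ 2 * b * c * d + a ^ 2 * conj c * d
            + a ^ 2 * conj b * c + a ^ 2 * conj d * b + a * b ^ 2 * d - 2 * a * b * c ^ 2
            + a * c * d ^ 2
            + conj b * conj d * c ^ 2 + b ^ 2 * c * conj a - 2 * b * d ^ 2 * conj a
            + c ^ 2 * d * conj a
            + a ^ 3 + (3 / 2 : ℂ) * a * b * conj c + (3 / 2 : ℂ) * a * conj b * d
            - 3 * a * c * conj d + b ^ 3 + b ^ 2 * conj (c * d) - 3 * b * c * d + c ^ 3
            + d ^ 3 + d ^ 2 * conj (b * c) : ℂ).re : ℝ) : ℂ)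
        + (5 / 2 : ℂ) * (‖a * b‖ : ℂ) ^ 2 + (‖c * d‖ : ℂ) ^ 2
        - (9 / 2 : ℂ) * ((‖a‖ : ℂ) ^ 2 + (‖b‖ : ℂ) ^ 2 + (‖c‖ : ℂ) ^ 2 + (‖d‖ : ℂ) ^ 2)
        + 27 / 4 := by
  obtain ⟨hS, hD⟩ := commTraceIdentity (SU21.toMatrix A) (SU21.toMatrix B)
  simp only [← SU21.toMatrix_inv, SU21.det_toMatrix, ← map_mul, ← SU21.trSU21_eq] at hS hD
  have hc' : trSU21 (B⁻¹ * A⁻¹) = conj c := by rw [hc, ← SU21.trSU21_inv, mul_inv_rev]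
  have hd' : trSU21 (B⁻¹ * A) = conj d := by rw [hd, ← SU21.trSU21_inv, mul_inv_rev, inv_inv]
  have ht : trSU21 (B * A * B⁻¹ * A⁻¹) = conj (trSU21 (A * B * A⁻¹ * B⁻¹)) := by
    rw [← SU21.trSU21_inv]
    congr 1
    group
  rw [ht, hc', hd', SU21.trSU21_inv, SU21.trSU21_inv, ← ha, ← hb, ← hc, ← hd] at hS hD
  generalize trSU21 (A * B * A⁻¹ * B⁻¹) = t at hS hD
  have him : ((t.im : ℝ) : ℂ) ^ 2 = -(1 / 4) * (t - conj t) ^ 2 := by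
    rw [Complex.sub_conj, mul_pow, Complex.I_sq]
    push_cast
    ring
  -- Squared norms and real parts are expanded through conjugates, so both claims become polynomial
  -- identities in a, b, c, d and their conjugates.
  simp only [← Complex.mul_conj', him, Complex.re_eq_add_conj, hS, hD, commTraceSum,
    commTraceDisc, map_add, map_sub, map_mul, map_neg, map_pow, map_ofNat, map_div₀,
    Complex.conj_conj]
  constructor <;> ring
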